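/- Let $A$ be a (not necessarily unital) $C^*$-algebra and let $x=(x_1,\dots,x_n)$ and $y=(y_1,\dots,y_n)$ be $n$-tuples of elements of $A$ such that the $x_i$ commute with each other, the $y_i$ commute with each other, and $0\le x_i\le y_i$ for $i=1,\dots,n$ (no commutation between the $x_i$ and the $y_j$ is assumed). (1) Let $\varphi\colon A\to\mathbf C$ be a positive linear functional, and assume that all $x_i$ and all $y_i$ belong to the centralizer $$A^{\varphi}=\{y\in A \mid \varphi(xy)=\varphi(yx)\ \text{for all } x\in A\}.$$ Then $$\varphi(x_1^{p_1}\cdots x_n^{p_n})\le\varphi(y_1^{p_1}\cdots y_n^{p_n})$$ for all real exponents $p_1,\dots,p_n\ge 0$. (2) In particular, if $\tau$ is a trace on $A$, that is, a positive linear functional $\tau\colon A\to\mathbf C$ with $\tau(ab)=\tau(ba)$ for all $a,b\in A$, then $$\tau(x_1\cdots x_n)\le\tau(y_1\cdots y_n).$$ Here powers are formed by the continuous functional calculus, with $a^0=1$ (also for $a=0$). If all exponents are zero or $n=0$, the products are the unit of the unitization $A\oplus\mathbf C1$ of $A$, on which $\varphi$ is evaluated through its canonical extension $\varphi(a+c1)=\varphi(a)+c\|\varphi\|$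 (so that the value at the unit is $\varphi(1_A)$ if $A$ is unital). -/

import Mathlib

open scoped ComplexOrder

namespace MonotoneTrace

/-- The centralizer of a functional `φ` on `A`: all `y` such that `φ (x * y) = φ (y * x)` for
every `x` in `A`. -/
def centralizer {A : Type*} [NonUnitalCStarAlgebra A] [PartialOrder A] [StarOrderedRing A]
    (φ : A →ₚ[ℂ] ℂ) : Set A :=
  {y | ∀ x : A, φ (x * y) = φ (y * x)}

/-- A (finite) trace: a positive functional `τ` with `τ (a * b) = τ (b * a)` for all `a`, `b`. -/
def IsTrace {A : Type*} [NonUnitalCStarAlgebra A] [PartialOrder A] [StarOrderedRing A]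
    (τ : A →ₚ[ℂ] ℂ) : Prop :=
  ∀ a b : A, τ (a * b) = τ (b * a)

/-- The canonical extension of a positive functional `φ` on a (not necessarily unital)
C⋆-algebra `A` to the unitization of `A`, namely `(c, a) ↦ c * ‖φ‖ + φ a`. Positive functionals
are automatically bounded, so `‖φ‖` is the usual operator norm; if `A` has a unit then
`‖φ‖ = φ 1`. -/
noncomputable def extend {A : Type*} [NonUnitalCStarAlgebra A] [PartialOrder A]
    [StarOrderedRing A] (φ : A →ₚ[ℂ] ℂ) (z : Unitization ℂ A) : ℂ :=
  z.fst * (‖(⟨φ.toLinearMap, map_continuous φ⟩ : A →L[ℂ] ℂ)‖ : ℂ) + φ z.snd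

theorem extend_inr {A : Type*} [NonUnitalCStarAlgebra A] [PartialOrder A]
    [StarOrderedRing A] (φ : A →ₚ[ℂ] ℂ) (a : A) : extend φ (a : Unitization ℂ A) = φ a := by
  simp [extend]

/-- The power `a ^ p` of a positive element `a` with exponent `0 ≤ p`, through the continuous
functional calculus. It is formed in the unitization because `a ^ 0 = 1`; for `0 < p` it lies
in `A`. -/
noncomputable def power {A : Type*} [NonUnitalCStarAlgebra A] (a : A) (p : ℝ) :
    Unitization ℂ A :=
  cfc (fun t : ℝ => t ^ p) (a : Unitization ℂ A)

end MonotoneTrace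

/-!
After every `x i` and `y i` is replaced by `x i + ε` and `y i + ε` in the unitization, all the
elements are strictly positive, and commutativity turns the product into a single exponential:
`∏ (x i) ^ (p i) = exp (∑ p i • log (x i))`. The logarithm is operator monotone, so
`∑ p i • log (x i) ≤ ∑ p i • log (y i)`. These two sums need not commute, but both lie in the
centralizer of the functional, and on the centralizer the functional is a trace; hence
`φ (exp a) ≤ φ (exp b)` whenever `a ≤ b` (`apply_exp_le_apply_exp`). Letting `ε` tend to `0`
gives the inequality (`apply_prod_rpow_le`).

Monotonicity of `φ ∘ exp` is reduced to that of `φ (a ^ m)` for `0 ≤ a` (`apply_pow_le_apply_pow`)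
by a scalar shift and the exponential series. With `z t = a + t • (b - a)`, the trace property
shows that every term of the derivative of `φ (z t ^ m)` equals `φ (z t ^ (m - 1) * (b - a))`, which
is nonnegative.

The argument takes place in the unitization, so the canonical extension of `φ` has to be positive.
This is a discriminant computation resting on `‖φ a‖ ^ 2 ≤ ‖φ‖ * φ (star a * a)`
(`norm_sq_apply_le`), itself Cauchy–Schwarz for `φ` against an approximate unit.
-/

namespace MonotoneTrace

open Filter Topology CFC

/-! ### Positivity of the canonical extension to the unitization -/

section Extension

variable {A : Type*} [NonUnitalCStarAlgebra A] [PartialOrder A] [StarOrderedRing A]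

/-- The inequality `‖φ a‖ ^ 2 ≤ ‖φ‖ * φ (star a * a)`: the Cauchy–Schwarz inequality for
`φ (e * a)`, in the limit as `e` runs through an approximate unit. -/
theorem norm_sq_apply_le (φ : A →ₚ[ℂ] ℂ) (a : A) :
    ‖φ a‖ ^ 2 ≤ ‖(⟨φ.toLinearMap, map_continuous φ⟩ : A →L[ℂ] ℂ)‖ * (φ (star a * a)).re := by
  set N := ‖(⟨φ.toLinearMap, map_continuous φ⟩ : A →L[ℂ] ℂ)‖ with hN
  have h0 (b : A) : 0 ≤ (φ (star b * b)).re :=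
    (Complex.nonneg_iff.mp (φ.map_nonneg (star_mul_self_nonneg b))).1
  have hu := CStarAlgebra.increasingApproximateUnit A
  have := hu.neBot
  have htend : Tendsto (fun e ↦ ‖φ (e * a)‖ ^ 2) (CStarAlgebra.approximateUnit A)
      (𝓝 (‖φ a‖ ^ 2)) :=
    ((((map_continuous φ).tendsto a).comp (hu.tendsto_mul_right a)).norm).pow 2
  refine le_of_tendsto htend ?_
  filter_upwards [hu.eventually_norm, hu.eventually_star_eq] with e he hes
  have hcs := norm_inner_le_norm (𝕜 := ℂ) (φ.toPreGNS e) (φ.toPreGNS a)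
  rw [φ.preGNS_inner_def, φ.preGNS_norm_def, φ.preGNS_norm_def] at hcs
  simp only [φ.ofPreGNS_toPreGNS] at hcs
  have hcs' : ‖φ (e * a)‖ ^ 2 ≤ (φ (star e * e)).re * (φ (star a * a)).re := by
    rw [hes] at hcs
    calc ‖φ (e * a)‖ ^ 2 ≤ (√(φ (e * e)).re * √(φ (star a * a)).re) ^ 2 := by gcongr
      _ = _ := by
        have := h0 e
        rw [hes] at this
        rw [mul_pow, Real.sq_sqrt this, Real.sq_sqrt (h0 a), hes]
  refine hcs'.trans (mul_le_mul_of_nonneg_right ?_ (h0 a))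
  calc (φ (star e * e)).re ≤ ‖φ (star e * e)‖ := Complex.re_le_norm _
    _ ≤ N * ‖star e * e‖ :=
      (⟨φ.toLinearMap, map_continuous φ⟩ : A →L[ℂ] ℂ).le_opNorm (star e * e)
    _ ≤ N * 1 := by
      gcongr
      rw [CStarRing.norm_star_mul_self]
      exact mul_le_one₀ he (norm_nonneg _) he
    _ = N := mul_one N

theorem extend_star_mul_self_nonneg (φ : A →ₚ[ℂ] ℂ) (z : Unitization ℂ A) :
    0 ≤ extend φ (star z * z) := by
  have hcs := norm_sq_apply_le φ z.snd
  have hpos := Complex.nonneg_iff.mp (φ.map_nonneg (star_mul_self_nonneg z.snd))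
  set N := ‖(⟨φ.toLinearMap, map_continuous φ⟩ : A →L[ℂ] ℂ)‖ with hN
  have hN0 : 0 ≤ N := norm_nonneg _
  -- The value is `|c|² N + 2 Re (conj c * φ a) + φ (star a * a)`, where `z = (c, a)` and `N = ‖φ‖`.
  have key : extend φ (star z * z) =
      ((‖z.fst‖ ^ 2 * N + 2 * (star z.fst * φ z.snd).re + (φ (star z.snd * z.snd)).re : ℝ) : ℂ) := by
    have hre : (((φ (star z.snd * z.snd)).re : ℝ) : ℂ) = φ (star z.snd * z.snd) :=
      Complex.ext (by simp) (by simpa using hpos.2)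
    have h2 : (((2 * (star z.fst * φ z.snd).re : ℝ)) : ℂ)
        = star z.fst * φ z.snd + z.fst * star (φ z.snd) := by
      have := Complex.add_conj (star z.fst * φ z.snd)
      rw [← this]; simp
    have h3 : ((‖z.fst‖ ^ 2 * N : ℝ) : ℂ) = star z.fst * z.fst * N := by
      push_cast
      rw [← Complex.conj_mul' z.fst]; rfl
    rw [Complex.ofReal_add, Complex.ofReal_add, hre, h2, h3]
    simp only [extend, ← hN, Unitization.fst_mul, Unitization.snd_mul, Unitization.fst_star,
      Unitization.snd_star, map_add, map_smul, smul_eq_mul, map_star]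
    ring
  rw [key]
  refine Complex.zero_le_real.mpr ?_
  set c := ‖z.fst‖
  set s := ‖φ z.snd‖
  have hb : -(c * s) ≤ (star z.fst * φ z.snd).re := by
    have := Complex.abs_re_le_norm (star z.fst * φ z.snd)
    rw [norm_mul, norm_star] at this
    exact (abs_le.mp this).1
  have hc : 0 ≤ c := norm_nonneg _
  have hs : 0 ≤ s := norm_nonneg _
  -- As a quadratic form in `c`, this has nonpositive discriminant by `hcs`.
  rcases hN0.eq_or_lt with h | h
  · rw [← h] at hcs ⊢
    have hs0 : s = 0 := by nlinarith
    rw [hs0] at hb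
    nlinarith [hpos.1]
  · have : 0 ≤ N * (c ^ 2 * N - 2 * (c * s) + (φ (star z.snd * z.snd)).re) := by
      nlinarith [sq_nonneg (N * c - s)]
    nlinarith [nonneg_of_mul_nonneg_right this h]

/-- The canonical extension of a positive functional to the unitization, as a positive
functional. -/
noncomputable def extendPositive (φ : A →ₚ[ℂ] ℂ) : Unitization ℂ A →ₚ[ℂ] ℂ :=
  .mk₀
    { toFun := extend φ
      map_add' := fun a b ↦ by
        simp only [extend, Unitization.fst_add, Unitization.snd_add, map_add]
        ring
      map_smul' := fun c a ↦ by
        simp only [extend, Unitization.fst_smul, Unitization.snd_smul, map_smul, smul_eq_mul,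
          RingHom.id_apply]
        ring }
    fun z hz ↦ by
      obtain ⟨w, rfl⟩ := CStarAlgebra.nonneg_iff_eq_star_mul_self.mp hz
      exact extend_star_mul_self_nonneg φ w

@[simp]
theorem extendPositive_apply (φ : A →ₚ[ℂ] ℂ) (z : Unitization ℂ A) :
    extendPositive φ z = extend φ z := rfl

end Extension

/-! ### Monotonicity of the functional on its centralizer -/

section Centralizer

variable {U : Type*} [CStarAlgebra U] [PartialOrder U] [StarOrderedRing U]

/-- The centralizer of a positive functional on a unital C⋆-algebra, as a star subalgebra. -/
def centralizerStarSubalgebra (φ : U →ₚ[ℂ] ℂ) : StarSubalgebra ℂ U where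
  carrier := centralizer φ
  mul_mem' {a b} ha hb x := by
    rw [← mul_assoc, hb, ← mul_assoc, ha, mul_assoc]
  add_mem' {a b} ha hb x := by
    rw [mul_add, add_mul, map_add, map_add, ha x, hb x]
  algebraMap_mem' r x := by rw [Algebra.commutes]
  star_mem' {a} ha x := by
    have := congrArg star (ha (star x))
    rw [← map_star, ← map_star] at this
    simpa using this.symm

theorem mem_centralizerStarSubalgebra {φ : U →ₚ[ℂ] ℂ} {a : U} :
    a ∈ centralizerStarSubalgebra φ ↔ ∀ x, φ (x * a) = φ (a * x) := Iff.rfl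

theorem isClosed_centralizerStarSubalgebra (φ : U →ₚ[ℂ] ℂ) :
    IsClosed (centralizerStarSubalgebra φ : Set U) := by
  have : (centralizerStarSubalgebra φ : Set U) = ⋂ x, {a | φ (x * a) = φ (a * x)} := by
    ext a; simp [mem_centralizerStarSubalgebra]
  rw [this]
  have hφ : Continuous φ := map_continuous φ
  exact isClosed_iInter fun x ↦ isClosed_eq (by fun_prop) (by fun_prop)

theorem cfc_mem_centralizerStarSubalgebra {φ : U →ₚ[ℂ] ℂ} (f : ℝ → ℝ) {a : U}
    (ha : a ∈ centralizerStarSubalgebra φ) : cfc f a ∈ centralizerStarSubalgebra φ :=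
  have := isClosed_centralizerStarSubalgebra φ
  cfc_mem f ha

/-- With `s` the square root of `u`, which again lies in the centralizer,
`φ (u * d) = φ (s * d * s)`. -/
theorem apply_mul_nonneg {φ : U →ₚ[ℂ] ℂ} {u d : U} (hu : u ∈ centralizerStarSubalgebra φ)
    (hu0 : 0 ≤ u) (hd : 0 ≤ d) : 0 ≤ φ (u * d) := by
  have hs : cfc Real.sqrt u ∈ centralizerStarSubalgebra φ :=
    cfc_mem_centralizerStarSubalgebra _ hu
  have hsa : IsSelfAdjoint (cfc Real.sqrt u) := cfc_predicate _ u
  have hmul : cfc Real.sqrt u * cfc Real.sqrt u = u := by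
    rw [← cfc_mul ..]
    conv_rhs => rw [← cfc_id' ℝ u]
    exact cfc_congr fun t ht ↦ Real.mul_self_sqrt (spectrum_nonneg_of_nonneg hu0 ht)
  rw [← hmul, mul_assoc, ← mem_centralizerStarSubalgebra.mp hs]
  exact φ.map_nonneg (hsa.conjugate_nonneg hd)

/-- The order on `ℂ` also compares imaginary parts; they vanish on self-adjoint elements. -/
theorem apply_le_of_re_le {φ : U →ₚ[ℂ] ℂ} {a b : U} (ha : IsSelfAdjoint a) (hb : IsSelfAdjoint b)
    (h : (φ a).re ≤ (φ b).re) : φ a ≤ φ b := by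
  have him {c : U} (hc : IsSelfAdjoint c) : (φ c).im = 0 :=
    Complex.conj_eq_iff_im.mp (by rw [← Complex.star_def, ← map_star, hc.star_eq])
  exact Complex.le_def.mpr ⟨h, by rw [him ha, him hb]⟩

/-- Powers are monotone under a functional that is tracial on the elements involved, although
`a ↦ a ^ m` is not operator monotone for `2 ≤ m`. -/
theorem apply_pow_le_apply_pow {φ : U →ₚ[ℂ] ℂ} {a b : U} (ha : a ∈ centralizerStarSubalgebra φ)
    (hb : b ∈ centralizerStarSubalgebra φ) (ha0 : 0 ≤ a) (hab : a ≤ b) (m : ℕ) :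
    φ (a ^ m) ≤ φ (b ^ m) := by
  refine apply_le_of_re_le (ha0.isSelfAdjoint.pow m) ((ha0.trans hab).isSelfAdjoint.pow m) ?_
  let L : U →L[ℝ] ℝ := Complex.reCLM.comp
    ((⟨φ.toLinearMap, map_continuous φ⟩ : U →L[ℂ] ℂ).restrictScalars ℝ)
  let z : ℝ → U := fun t ↦ a + t • (b - a)
  have hz (t : ℝ) : HasDerivAt z (b - a) t := by
    simpa [z] using ((hasDerivAt_id t).smul_const (b - a)).const_add a
  have hderiv (t : ℝ) := L.hasFDerivAt.comp_hasDerivAt t ((hz t).fun_pow' m)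
  have hmono : MonotoneOn (fun t ↦ L (z t ^ m)) (Set.Icc 0 1) := by
    refine monotoneOn_of_deriv_nonneg (convex_Icc 0 1)
      (fun t _ ↦ (hderiv t).continuousAt.continuousWithinAt)
      (fun t _ ↦ (hderiv t).differentiableAt.differentiableWithinAt) fun t ht ↦ ?_
    rw [interior_Icc] at ht
    refine (hderiv t).deriv.symm ▸ ?_
    rw [map_sum]
    -- By the trace property the `i`-th term is `φ (z t ^ (i + (m - 1 - i)) * (b - a))`.
    refine Finset.sum_nonneg fun i _ ↦ ?_
    have hzt : z t ∈ centralizerStarSubalgebra φ := by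
      have : (t • (b - a) : U) = (t : ℂ) • (b - a) := (Complex.coe_smul t (b - a)).symm
      simp only [z, this]
      exact add_mem ha (SMulMemClass.smul_mem _ (sub_mem hb ha))
    have hzt0 : 0 ≤ z t := add_nonneg ha0 (smul_nonneg ht.1.le (sub_nonneg.mpr hab))
    have h := apply_mul_nonneg (φ := φ) (pow_mem hzt (i + (m.pred - i)))
      (CStarAlgebra.pow_nonneg hzt0 _) (sub_nonneg.mpr hab)
    rw [pow_add, mul_assoc, ← mem_centralizerStarSubalgebra.mp (pow_mem hzt i)] at h
    exact (Complex.nonneg_iff.mp h).1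
  have := hmono (Set.left_mem_Icc.mpr zero_le_one) (Set.right_mem_Icc.mpr zero_le_one) zero_le_one
  simpa [z, L] using this

open NormedSpace in
/-- The exponential is monotone under a functional that is tracial on the elements involved. -/
theorem apply_exp_le_apply_exp {φ : U →ₚ[ℂ] ℂ} {a b : U} (ha : a ∈ centralizerStarSubalgebra φ)
    (hb : b ∈ centralizerStarSubalgebra φ) (hsa : IsSelfAdjoint a) (hab : a ≤ b) :
    φ (exp a) ≤ φ (exp b) := by
  have : OrderClosedTopology ℂ := Complex.orderClosedTopology
  -- The shift by `‖a‖` makes both elements nonnegative and only rescales the exponentials.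
  set r : ℝ := ‖a‖
  have hr : algebraMap ℝ U r = algebraMap ℂ U (r : ℂ) := by
    rw [IsScalarTower.algebraMap_apply ℝ ℂ U]; rfl
  let +nondep : NormedAlgebra ℚ U := .restrictScalars ℚ ℝ U
  have hshift (c : U) : exp c = (Real.exp (-r) : ℝ) • exp (c + algebraMap ℝ U r) := by
    rw [exp_add_of_commute (Algebra.commutes r c).symm, ← algebraMap_exp_comm, ← Real.exp_eq_exp_ℝ,
      ← Algebra.commutes, ← Algebra.smul_def, smul_smul, ← Real.exp_add]
    simp
  have hpos {c d : U} (hc : c ∈ centralizerStarSubalgebra φ)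
      (hd : d ∈ centralizerStarSubalgebra φ) (hc0 : 0 ≤ c) (hcd : c ≤ d) :
      φ (exp c) ≤ φ (exp d) := by
    have hsum (c : U) := (exp_series_hasSum_exp' (𝕂 := ℝ) c).map φ (map_continuous φ)
    refine hasSum_le (fun n ↦ ?_) (hsum c) (hsum d)
    simp only [Function.comp_apply, PositiveLinearMap.map_smul_of_tower]
    exact smul_le_smul_of_nonneg_left (apply_pow_le_apply_pow hc hd hc0 hcd n) (by positivity)
  rw [hshift a, hshift b, PositiveLinearMap.map_smul_of_tower, PositiveLinearMap.map_smul_of_tower]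
  refine smul_le_smul_of_nonneg_left (hpos ?_ ?_ ?_ (by gcongr)) (Real.exp_nonneg _)
  · exact add_mem ha (by rw [hr]; exact algebraMap_mem _ _)
  · exact add_mem hb (by rw [hr]; exact algebraMap_mem _ _)
  · have := hsa.neg_algebraMap_norm_le_self
    simpa [r] using add_le_add_left this (algebraMap ℝ U ‖a‖)

end Centralizer

/-! ### Products of powers of commuting elements -/

section Products

open NormedSpace in
theorem prod_ofFn_exp {U : Type*} [CStarAlgebra U] {n : ℕ} (a : Fin n → U)
    (ha : ∀ i j, Commute (a i) (a j)) :
    (List.ofFn fun i ↦ exp (a i)).prod = exp (∑ i, a i) := by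
  let +nondep : NormedAlgebra ℚ U := .restrictScalars ℚ ℝ U
  induction n with
  | zero => simp
  | succ n ih =>
    rw [List.ofFn_succ, List.prod_cons, ih (fun i ↦ a i.succ) fun i j ↦ ha _ _, Fin.sum_univ_succ,
      exp_add_of_commute (Commute.sum_right _ _ _ fun i _ ↦ ha _ _)]

theorem continuous_prod_ofFn_rpow_add_algebraMap {U : Type*} [CStarAlgebra U] {n : ℕ}
    {x : Fin n → U} (hx : ∀ i, IsSelfAdjoint (x i)) {p : Fin n → ℝ} (hp : ∀ i, 0 ≤ p i) :
    Continuous fun ε : ℝ ↦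
      (List.ofFn fun i ↦ cfc (fun t : ℝ ↦ t ^ p i) (x i + algebraMap ℝ U ε)).prod := by
  simp only [List.ofFn_eq_map]
  refine continuous_list_prod _ fun i _ ↦ ?_
  exact Continuous.cfc_of_mem_nhdsSet (s := Set.univ) _ univ_mem (by fun_prop)
    (fun ε ↦ (hx i).add (.algebraMap U (.all ε))) (Real.continuous_rpow_const (hp i)).continuousOn

variable {U : Type*} [CStarAlgebra U] [PartialOrder U] [StarOrderedRing U]

open NormedSpace in
theorem cfc_rpow_eq_exp {a : U} (ha : IsStrictlyPositive a) (p : ℝ) :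
    cfc (fun t : ℝ ↦ t ^ p) a = exp (p • log a) := by
  have hsa : IsSelfAdjoint a := ha.nonneg.isSelfAdjoint
  have hpos : ∀ t ∈ spectrum ℝ a, 0 < t := fun t ht ↦ ha.spectrum_pos ht
  have hlog : ContinuousOn Real.log (spectrum ℝ a) :=
    Real.continuousOn_log.mono fun t ht ↦ (hpos t ht).ne'
  have hsl : IsSelfAdjoint (p • log a) := (IsSelfAdjoint.all p).smul IsSelfAdjoint.log
  rw [← real_exp_eq_normedSpace_exp hsl, log, ← cfc_smul .., ← cfc_comp' Real.exp _ a ..]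
  refine cfc_congr fun t ht ↦ ?_
  rw [Real.rpow_def_of_pos (hpos t ht), smul_eq_mul, mul_comm]

open NormedSpace in
theorem prod_ofFn_rpow_eq_exp {n : ℕ} {x : Fin n → U} (hx : ∀ i j, Commute (x i) (x j))
    (hx0 : ∀ i, IsStrictlyPositive (x i)) (p : Fin n → ℝ) :
    (List.ofFn fun i ↦ cfc (fun t : ℝ ↦ t ^ p i) (x i)).prod = exp (∑ i, p i • log (x i)) := by
  simp only [cfc_rpow_eq_exp (hx0 _)]
  exact prod_ofFn_exp _ fun i j ↦
    ((((hx i j).cfc_real Real.log).symm.cfc_real Real.log).symm.smul_left _).smul_right _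

/-- The inequality for strictly positive elements, where logarithms are available. -/
theorem apply_prod_rpow_le_of_isStrictlyPositive {φ : U →ₚ[ℂ] ℂ} {n : ℕ} {x y : Fin n → U}
    (hx : ∀ i j, Commute (x i) (x j)) (hy : ∀ i j, Commute (y i) (y j))
    (hx0 : ∀ i, IsStrictlyPositive (x i)) (hxy : ∀ i, x i ≤ y i)
    (hxφ : ∀ i, x i ∈ centralizerStarSubalgebra φ) (hyφ : ∀ i, y i ∈ centralizerStarSubalgebra φ)
    {p : Fin n → ℝ} (hp : ∀ i, 0 ≤ p i) :
    φ (List.ofFn fun i ↦ cfc (fun t : ℝ ↦ t ^ p i) (x i)).prod ≤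
      φ (List.ofFn fun i ↦ cfc (fun t : ℝ ↦ t ^ p i) (y i)).prod := by
  rw [prod_ofFn_rpow_eq_exp hx hx0, prod_ofFn_rpow_eq_exp hy fun i ↦ (hx0 i).of_le (hxy i)]
  have hmem {z : Fin n → U} (hz : ∀ i, z i ∈ centralizerStarSubalgebra φ) :
      ∑ i, p i • log (z i) ∈ centralizerStarSubalgebra φ :=
    sum_mem fun i _ ↦ by
      rw [← Complex.coe_smul]
      exact SMulMemClass.smul_mem _ (cfc_mem_centralizerStarSubalgebra _ (hz i))
  refine apply_exp_le_apply_exp (hmem hxφ) (hmem hyφ)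
    (isSelfAdjoint_sum _ fun i _ ↦ (IsSelfAdjoint.all (p i)).smul IsSelfAdjoint.log) ?_
  exact Finset.sum_le_sum fun i _ ↦
    smul_le_smul_of_nonneg_left (log_le_log (hxy i) (hx0 i)) (hp i)

/-- The inequality for a positive functional on a unital C⋆-algebra, obtained from the strictly
positive elements `x i + ε` and `y i + ε` as `ε` decreases to `0`. -/
theorem apply_prod_rpow_le {φ : U →ₚ[ℂ] ℂ} {n : ℕ} {x y : Fin n → U}
    (hx : ∀ i j, Commute (x i) (x j)) (hy : ∀ i j, Commute (y i) (y j))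
    (hx0 : ∀ i, 0 ≤ x i) (hxy : ∀ i, x i ≤ y i)
    (hxφ : ∀ i, x i ∈ centralizerStarSubalgebra φ) (hyφ : ∀ i, y i ∈ centralizerStarSubalgebra φ)
    {p : Fin n → ℝ} (hp : ∀ i, 0 ≤ p i) :
    φ (List.ofFn fun i ↦ cfc (fun t : ℝ ↦ t ^ p i) (x i)).prod ≤
      φ (List.ofFn fun i ↦ cfc (fun t : ℝ ↦ t ^ p i) (y i)).prod := by
  have : OrderClosedTopology ℂ := Complex.orderClosedTopology
  have hlim {z : Fin n → U} (hz : ∀ i, 0 ≤ z i) :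
      Tendsto (fun ε : ℝ ↦
          φ (List.ofFn fun i ↦ cfc (fun t : ℝ ↦ t ^ p i) (z i + algebraMap ℝ U ε)).prod)
        (𝓝[>] 0) (𝓝 (φ (List.ofFn fun i ↦ cfc (fun t : ℝ ↦ t ^ p i) (z i)).prod)) := by
    have := (map_continuous φ).comp
      (continuous_prod_ofFn_rpow_add_algebraMap (fun i ↦ (hz i).isSelfAdjoint) hp)
    simpa [Function.comp_def] using (this.tendsto 0).mono_left nhdsWithin_le_nhds
  have hcomm {z : Fin n → U} (hz : ∀ i j, Commute (z i) (z j)) (ε : ℝ) (i j : Fin n) :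
      Commute (z i + algebraMap ℝ U ε) (z j + algebraMap ℝ U ε) :=
    ((hz i j).add_right (Algebra.commutes ε _).symm).add_left
      (Algebra.commutes ε (z j + algebraMap ℝ U ε))
  have hmem {z : Fin n → U} (hz : ∀ i, z i ∈ centralizerStarSubalgebra φ) (ε : ℝ) (i : Fin n) :
      z i + algebraMap ℝ U ε ∈ centralizerStarSubalgebra φ :=
    add_mem (hz i) (by
      rw [IsScalarTower.algebraMap_apply ℝ ℂ U]
      exact algebraMap_mem _ _)
  refine le_of_tendsto_of_tendsto (hlim hx0) (hlim fun i ↦ (hx0 i).trans (hxy i)) ?_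
  filter_upwards [self_mem_nhdsWithin] with ε (hε : 0 < ε)
  exact apply_prod_rpow_le_of_isStrictlyPositive (hcomm hx ε) (hcomm hy ε)
    (fun i ↦ .nonneg_add (hx0 i) (isStrictlyPositive_algebraMap hε))
    (fun i ↦ by gcongr; exact hxy i) (hmem hxφ ε) (hmem hyφ ε) hp

end Products

theorem inr_mem_centralizerStarSubalgebra {A : Type*} [NonUnitalCStarAlgebra A] [PartialOrder A]
    [StarOrderedRing A] {φ : A →ₚ[ℂ] ℂ} {a : A} (ha : a ∈ centralizer φ) :
    (a : Unitization ℂ A) ∈ centralizerStarSubalgebra (extendPositive φ) := fun z ↦ by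
  simp [extend, ha z.snd]

theorem power_one {A : Type*} [NonUnitalCStarAlgebra A] {a : A} (ha : IsSelfAdjoint a) :
    power a 1 = a := by
  simp only [power, Real.rpow_one]
  exact cfc_id' ℝ (a : Unitization ℂ A) (ha.inr ℂ)

end MonotoneTrace

theorem mainTheorem1 {A : Type*} [NonUnitalCStarAlgebra A] [PartialOrder A] [StarOrderedRing A]
    {n : ℕ} (x y : Fin n → A)
    (hx : ∀ i j, Commute (x i) (x j)) (hy : ∀ i j, Commute (y i) (y j))
    (hx0 : ∀ i, 0 ≤ x i) (hxy : ∀ i, x i ≤ y i) :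
    (∀ φ : A →ₚ[ℂ] ℂ,
      (∀ i, x i ∈ MonotoneTrace.centralizer φ) → (∀ i, y i ∈ MonotoneTrace.centralizer φ) →
      ∀ p : Fin n → ℝ, (∀ i, 0 ≤ p i) →
        MonotoneTrace.extend φ (List.ofFn fun i => MonotoneTrace.power (x i) (p i)).prod ≤
          MonotoneTrace.extend φ (List.ofFn fun i => MonotoneTrace.power (y i) (p i)).prod) ∧
    (∀ τ : A →ₚ[ℂ] ℂ, MonotoneTrace.IsTrace τ →
      MonotoneTrace.extend τ (List.ofFn fun i => (x i : Unitization ℂ A)).prod ≤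
        MonotoneTrace.extend τ (List.ofFn fun i => (y i : Unitization ℂ A)).prod) := by
  have hy0 i : 0 ≤ y i := (hx0 i).trans (hxy i)
  have hinr {z : Fin n → A} (hz : ∀ i j, Commute (z i) (z j)) (i j : Fin n) :
      Commute (z i : Unitization ℂ A) (z j) := by
    rw [commute_iff_eq, ← Unitization.inr_mul, ← Unitization.inr_mul, (hz i j).eq]
  have main (φ : A →ₚ[ℂ] ℂ) (hxφ : ∀ i, x i ∈ MonotoneTrace.centralizer φ)
      (hyφ : ∀ i, y i ∈ MonotoneTrace.centralizer φ) (p : Fin n → ℝ) (hp : ∀ i, 0 ≤ p i) :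
      MonotoneTrace.extend φ (List.ofFn fun i => MonotoneTrace.power (x i) (p i)).prod ≤
        MonotoneTrace.extend φ (List.ofFn fun i => MonotoneTrace.power (y i) (p i)).prod :=
    MonotoneTrace.apply_prod_rpow_le (φ := MonotoneTrace.extendPositive φ) (hinr hx) (hinr hy)
      (fun i ↦ Unitization.inr_nonneg_iff.mpr (hx0 i))
      (fun i ↦ (Unitization.inr_le_iff _ _ (hx0 i).isSelfAdjoint (hy0 i).isSelfAdjoint).mpr (hxy i))
      (fun i ↦ MonotoneTrace.inr_mem_centralizerStarSubalgebra (hxφ i))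
      (fun i ↦ MonotoneTrace.inr_mem_centralizerStarSubalgebra (hyφ i)) hp
  refine ⟨main, fun τ hτ ↦ ?_⟩
  -- The centralizer of a trace is everything, and all exponents equal to `1` give the product.
  have h := main τ (fun i a ↦ hτ a (x i)) (fun i a ↦ hτ a (y i)) 1 fun _ ↦ zero_le_one
  simpa only [Pi.one_apply, MonotoneTrace.power_one (hx0 _).isSelfAdjoint,
    MonotoneTrace.power_one (hy0 _).isSelfAdjoint] using h
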